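/- A multipartite tournament is a finite digraph $D$ with at least one vertex whose vertex set can be divided into $\ell\ge 2$ classes such that there is no arc between two vertices of the same class, while any two vertices of different classes are joined by exactly one arc (in exactly one of the two directions). Let $\delta^+(D)$ denote the minimum out-degree of $D$, and let $k$ be a non-negative integer. If $D$ is a multipartite tournament with $\delta^+(D)\ge 3k-2$, then $D$ contains $k$ pairwise vertex-disjoint directed cycles. -/

import Mathlib

namespace Digraph

/-- The out-degree `d⁺(v)`: the number of out-neighbours of `v`. -/
noncomputable def outDegree {V : Type*} (D : Digraph V) (v : V) : ℕ :=
  {w : V | D.Adj v w}.ncard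

/-- The minimum out-degree `δ⁺(D)` (meaningful when `D` is finite with at least one vertex). -/
noncomputable def minOutDegree {V : Type*} (D : Digraph V) : ℕ :=
  ⨅ v : V, D.outDegree v

/-- `D` is an `ℓ`-partite tournament: its vertices are divided into `ℓ` classes such that there
is no arc inside a class, and any two vertices in different classes are joined by exactly one
arc, in exactly one of the two directions. (A class may be empty.) -/
def IsPartiteTournament {V : Type*} (D : Digraph V) (ℓ : ℕ) : Prop :=
  ∃ part : V → Fin ℓ,
    (∀ u v : V, part u = part v → ¬ D.Adj u v) ∧
    (∀ u v : V, part u ≠ part v → Xor (D.Adj u v) (D.Adj v u))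

/-- A multipartite tournament is an `ℓ`-partite tournament for some `ℓ ≥ 2`. -/
def IsMultipartiteTournament {V : Type*} (D : Digraph V) : Prop :=
  ∃ ℓ : ℕ, 2 ≤ ℓ ∧ D.IsPartiteTournament ℓ

/-- A directed cycle of `D`: a cyclic sequence of at least two distinct vertices, with an arc
of `D` from each one to the next (the last being followed by the first). -/
def IsDicycle {V : Type*} (D : Digraph V) (c : Cycle V) : Prop :=
  2 ≤ c.length ∧ c.Nodup ∧ c.Chain D.Adj

/-- `D` contains `k` pairwise vertex-disjoint directed cycles. -/
def HasDisjointDicycles {V : Type*} (D : Digraph V) (k : ℕ) : Prop :=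
  ∃ c : Fin k → Cycle V,
    (∀ i, D.IsDicycle (c i)) ∧ ∀ i j, i ≠ j → ∀ v, v ∈ c i → v ∉ c j

end Digraph

namespace Digraph

open Finset

/-! Induct on `k`: delete a dicycle containing at most three out-neighbours of each remaining
vertex, so that the minimum out-degree drops by at most 3. A directed triangle qualifies trivially.
Without one, pass to a strong subset; there adjacency is transitive between distinct classes. A
vertex of minimum out-degree starts a 4-cycle alternating between two classes (`exists_four_cycle`),
and strong connectivity prevents any vertex from dominating two consecutive vertices of it
(`not_dominates_four_cycle`). -/

open scoped Classical in
/-- The out-neighbours of `v` inside the finite vertex set `S`. -/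
noncomputable def outIn {V : Type*} (D : Digraph V) (S : Finset V) (v : V) : Finset V :=
  {w ∈ S | D.Adj v w}

section

variable {V : Type*} {D : Digraph V}

@[simp]
theorem mem_outIn {S : Finset V} {v w : V} : w ∈ D.outIn S v ↔ w ∈ S ∧ D.Adj v w := by
  simp [outIn]

theorem isDicycle_three {a b c : V} (hab : a ≠ b) (hac : a ≠ c) (hbc : b ≠ c)
    (h₁ : D.Adj a b) (h₂ : D.Adj b c) (h₃ : D.Adj c a) :
    D.IsDicycle (([a, b, c] : List V) : Cycle V) := by
  refine ⟨by simp, ?_, ?_⟩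
  · simp [Cycle.nodup_coe_iff, hab, hac, hbc]
  · simp [Cycle.chain_coe_cons, h₁, h₂, h₃]

theorem isDicycle_four {a b c d : V} (hab : a ≠ b) (hac : a ≠ c) (had : a ≠ d) (hbc : b ≠ c)
    (hbd : b ≠ d) (hcd : c ≠ d) (h₁ : D.Adj a b) (h₂ : D.Adj b c) (h₃ : D.Adj c d)
    (h₄ : D.Adj d a) :
    D.IsDicycle (([a, b, c, d] : List V) : Cycle V) := by
  refine ⟨by simp, ?_, ?_⟩
  · simp [Cycle.nodup_coe_iff, hab, hac, had, hbc, hbd, hcd]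
  · simp [Cycle.chain_coe_cons, h₁, h₂, h₃, h₄]

variable {ι : Type*} {part : V → ι}

/-- A multipartite tournament of positive minimum out-degree without directed triangles contains
a directed 4-cycle whose opposite vertices share a class. -/
theorem exists_four_cycle {S : Finset V} (hS : S.Nonempty)
    (hin : ∀ u v, part u = part v → ¬ D.Adj u v)
    (hadj : ∀ u v, part u ≠ part v → D.Adj u v ∨ D.Adj v u)
    (hasymm : ∀ u v, D.Adj u v → ¬ D.Adj v u)
    (hpos : ∀ v ∈ S, (D.outIn S v).Nonempty)
    (htri : ∀ a ∈ S, ∀ b ∈ S, ∀ c ∈ S, D.Adj a b → D.Adj b c → ¬ D.Adj c a) :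
    ∃ a ∈ S, ∃ b ∈ S, ∃ c ∈ S, ∃ d ∈ S, a ≠ c ∧ b ≠ d ∧ part a = part c ∧ part b = part d ∧
      D.Adj a b ∧ D.Adj b c ∧ D.Adj c d ∧ D.Adj d a := by
  obtain ⟨w, hw, hmin⟩ := S.exists_min_image (fun v => #(D.outIn S v)) hS
  obtain ⟨o, ho⟩ := hpos w hw
  obtain ⟨hoS, hwo⟩ := mem_outIn.1 ho
  have irr : ∀ v, ¬ D.Adj v v := fun v => hin v v rfl
  -- Otherwise the out-neighbourhood of `v` would lie inside that of `w` and miss `o`, contradicting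
  -- minimality.
  have key : ∀ v ∈ S, ¬ D.Adj v o → ∃ x ∈ S, D.Adj v x ∧ ¬ D.Adj w x := by
    intro v hv hvo
    by_contra! hcon
    refine absurd (hmin v hv) (not_le.2 (card_lt_card ?_))
    refine ⟨fun x hx => ?_, fun h => hvo (mem_outIn.1 (h ho)).2⟩
    obtain ⟨hxS, hvx⟩ := mem_outIn.1 hx
    exact mem_outIn.2 ⟨hxS, hcon x hxS hvx⟩
  obtain ⟨c, hcS, hoc, hwc⟩ := key o hoS (irr o)
  have hpc : part w = part c := by
    by_contra hne
    rcases hadj w c hne with h | h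
    · exact hwc h
    · exact htri w hw o hoS c hcS hwo hoc h
  have hco : ¬ D.Adj c o := hasymm o c hoc
  obtain ⟨d, hdS, hcd, hwd⟩ := key c hcS hco
  have hdw : D.Adj d w :=
    (hadj w d fun h => hin c d (hpc.symm.trans h) hcd).resolve_left hwd
  refine ⟨w, hw, o, hoS, c, hcS, d, hdS, ?_, ?_, hpc, ?_, hwo, hoc, hcd, hdw⟩
  · rintro rfl
    exact hwd hcd
  · rintro rfl
    exact hwd hwo
  · by_contra hne
    rcases hadj o d hne with h | h
    · exact htri w hw o hoS d hdS hwo h hdw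
    · exact htri o hoS c hcS d hdS hoc hcd h

/-- Every nonempty set inducing minimum out-degree at least `m` contains a strong one: a set with no
proper nonempty subset closed under out-neighbours. -/
theorem exists_closed_minimal {m : ℕ} {S : Finset V} (hS : S.Nonempty)
    (hdeg : ∀ v ∈ S, m ≤ #(D.outIn S v)) :
    ∃ T ⊆ S, T.Nonempty ∧ (∀ v ∈ T, m ≤ #(D.outIn T v)) ∧
      ∀ N ⊆ T, N.Nonempty → (∀ n ∈ N, ∀ u ∈ T, D.Adj n u → u ∈ N) → N = T := by
  induction S using Finset.strongInduction with
  | H S ih =>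
    by_cases h : ∀ N ⊆ S, N.Nonempty → (∀ n ∈ N, ∀ u ∈ S, D.Adj n u → u ∈ N) → N = S
    · exact ⟨S, Subset.rfl, hS, hdeg, h⟩
    · push Not at h
      obtain ⟨N, hNS, hN, hcl, hne⟩ := h
      obtain ⟨T, hT, hrest⟩ := ih N (hNS.ssubset_of_ne hne) hN fun v hv =>
        (hdeg v (hNS hv)).trans (card_le_card fun u hu => by
          obtain ⟨huS, hvu⟩ := mem_outIn.1 hu
          exact mem_outIn.2 ⟨hcl v hv u huS hvu, hvu⟩)
      exact ⟨T, hT.trans hNS, hrest⟩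

/-- In a strong multipartite tournament without directed triangles, no vertex dominates a
directed 4-cycle whose opposite vertices share a class. -/
theorem not_dominates_four_cycle {S : Finset V}
    (hin : ∀ u v, part u = part v → ¬ D.Adj u v)
    (hadj : ∀ u v, part u ≠ part v → D.Adj u v ∨ D.Adj v u)
    (hasymm : ∀ u v, D.Adj u v → ¬ D.Adj v u)
    (htri : ∀ a ∈ S, ∀ b ∈ S, ∀ c ∈ S, D.Adj a b → D.Adj b c → ¬ D.Adj c a)
    (hstrong : ∀ N ⊆ S, N.Nonempty → (∀ n ∈ N, ∀ u ∈ S, D.Adj n u → u ∈ N) → N = S)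
    {a b c d : V} (ha : a ∈ S) (hb : b ∈ S) (hc : c ∈ S) (hd : d ∈ S)
    (hac : part a = part c) (hbd : part b = part d)
    (hab : D.Adj a b) (hbc : D.Adj b c) (hcd : D.Adj c d) (hda : D.Adj d a)
    {t : V} (ht : t ∈ S) (hta : D.Adj t a) (htb : D.Adj t b) : False := by
  classical
  have trans : ∀ x ∈ S, ∀ y ∈ S, ∀ z ∈ S, D.Adj x y → D.Adj y z → part x ≠ part z →
      D.Adj x z := fun x hx y hy z hz hxy hyz hne =>
    (hadj x z hne).resolve_right (htri x hx y hy z hz hxy hyz)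
  have hne : ∀ {u v}, D.Adj u v → part u ≠ part v := fun h h' => hin _ _ h' h
  let T : Finset V := {t ∈ S | D.Adj t a ∧ D.Adj t b}
  let U : Finset V := {v ∈ S | (part v = part a ∨ part v = part b) ∧ ∃ t ∈ T, D.Adj v t}
  have memT : ∀ {v}, v ∈ T ↔ v ∈ S ∧ D.Adj v a ∧ D.Adj v b := by simp [T]
  have memU : ∀ {v}, v ∈ U ↔
      v ∈ S ∧ (part v = part a ∨ part v = part b) ∧ ∃ t ∈ T, D.Adj v t := by simp [U]
  have haN : a ∈ S \ (T ∪ U) := by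
    refine mem_sdiff.2 ⟨ha, fun h => ?_⟩
    rcases mem_union.1 h with h | h
    · exact hin a a rfl (memT.1 h).2.1
    · obtain ⟨-, -, s, hs, has⟩ := memU.1 h
      exact hasymm a s has (memT.1 hs).2.1
  -- No arc enters `T ∪ U` from outside: by transitivity, a tail in the class of `a` or `b` lies in
  -- `U`, and any other tail dominates both and lies in `T`.
  have hN : S \ (T ∪ U) = S := by
    refine hstrong _ sdiff_subset ⟨a, haN⟩ fun n hn u hu hnu => ?_
    obtain ⟨hnS, hnTU⟩ := mem_sdiff.1 hn
    refine mem_sdiff.2 ⟨hu, fun huTU => hnTU (mem_union.2 ?_)⟩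
    by_cases hcl : part n = part a ∨ part n = part b
    · right
      rcases mem_union.1 huTU with huT | huU
      · exact memU.2 ⟨hnS, hcl, u, huT, hnu⟩
      · obtain ⟨-, -, s, hs, hus⟩ := memU.1 huU
        obtain ⟨hsS, hsa, hsb⟩ := memT.1 hs
        refine memU.2 ⟨hnS, hcl, s, hs, trans n hnS u hu s hsS hnu hus ?_⟩
        rcases hcl with h | h <;> rw [h]
        exacts [(hne hsa).symm, (hne hsb).symm]
    · left
      obtain ⟨hna, hnb⟩ := not_or.1 hcl
      have of_a : D.Adj n a → n ∈ T := fun h =>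
        memT.2 ⟨hnS, h, trans n hnS a ha b hb h hab hnb⟩
      -- Domination propagates around the cycle from `b` through `c` and `d` to `a`.
      have of_b : D.Adj n b → n ∈ T := fun h => by
        have hnc := trans n hnS b hb c hc h hbc (hac ▸ hna)
        have hnd := trans n hnS c hc d hd hnc hcd (hbd ▸ hnb)
        exact of_a (trans n hnS d hd a ha hnd hda hna)
      rcases mem_union.1 huTU with huT | huU
      · exact of_a (trans n hnS u hu a ha hnu (memT.1 huT).2.1 hna)
      · obtain ⟨-, hua | hub, s, hs, hus⟩ := memU.1 huU <;>
          obtain ⟨hsS, hsa, hsb⟩ := memT.1 hs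
        · have hub := trans u hu s hsS b hb hus hsb (hua ▸ hne hab)
          exact of_b (trans n hnS u hu b hb hnu hub hnb)
        · have hua := trans u hu s hsS a ha hus hsa (hub ▸ (hne hab).symm)
          exact of_a (trans n hnS u hu a ha hnu hua hna)
  exact (mem_sdiff.1 (hN.symm.subset ht)).2
    (mem_union_left _ (memT.2 ⟨ht, hta, htb⟩))

/-- Every multipartite tournament of positive minimum out-degree on `S` contains, in a suitable
subset `T` of no smaller minimum out-degree, a directed cycle containing at most three
out-neighbours of each vertex of `T`. -/
theorem exists_light_dicycle {m : ℕ} (hm : 1 ≤ m) {S : Finset V} (hS : S.Nonempty)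
    (hin : ∀ u v, part u = part v → ¬ D.Adj u v)
    (hadj : ∀ u v, part u ≠ part v → D.Adj u v ∨ D.Adj v u)
    (hasymm : ∀ u v, D.Adj u v → ¬ D.Adj v u)
    (hdeg : ∀ v ∈ S, m ≤ #(D.outIn S v)) :
    ∃ T ⊆ S, T.Nonempty ∧ (∀ v ∈ T, m ≤ #(D.outIn T v)) ∧
      ∃ l : List V, D.IsDicycle (l : Cycle V) ∧ (∀ v ∈ l, v ∈ T) ∧
        ∀ C : Finset V, (∀ v, v ∈ C ↔ v ∈ l) → ∀ v ∈ T, #(D.outIn C v) ≤ 3 := by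
  classical
  obtain ⟨T, hTS, hT, hdegT, hstrong⟩ := exists_closed_minimal hS hdeg
  refine ⟨T, hTS, hT, hdegT, ?_⟩
  have ne_of_adj : ∀ {u v}, D.Adj u v → u ≠ v := fun h h' => hin _ _ (h' ▸ rfl) h
  by_cases htri : ∀ a ∈ T, ∀ b ∈ T, ∀ c ∈ T, D.Adj a b → D.Adj b c → ¬ D.Adj c a
  · obtain ⟨a, ha, b, hb, c, hc, d, hd, hac, hbd, hpac, hpbd, hab, hbc, hcd, hda⟩ :=
      exists_four_cycle hT hin hadj hasymm
        (fun v hv => card_pos.1 (hm.trans (hdegT v hv))) htri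
    refine ⟨[a, b, c, d], isDicycle_four (ne_of_adj hab) hac (ne_of_adj hda).symm
      (ne_of_adj hbc) hbd (ne_of_adj hcd) hab hbc hcd hda, by simp [ha, hb, hc, hd],
      fun C hC v hv => ?_⟩
    have hsub : ∃ x y z, D.outIn C v ⊆ {x, y, z} := by
      by_cases hva : D.Adj v a
      · refine ⟨a, c, d, fun u hu => ?_⟩
        obtain ⟨huC, hvu⟩ := mem_outIn.1 hu
        have hub : u ≠ b := by
          rintro rfl
          exact not_dominates_four_cycle hin hadj hasymm htri hstrong ha hb hc hd hpac hpbd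
            hab hbc hcd hda hv hva hvu
        simpa [hC, hub] using huC
      · refine ⟨b, c, d, fun u hu => ?_⟩
        obtain ⟨huC, hvu⟩ := mem_outIn.1 hu
        have hua : u ≠ a := by
          rintro rfl
          exact hva hvu
        simpa [hC, hua] using huC
    obtain ⟨x, y, z, h⟩ := hsub
    exact (card_le_card h).trans card_le_three
  · push Not at htri
    obtain ⟨a, ha, b, hb, c, hc, hab, hbc, hca⟩ := htri
    refine ⟨[a, b, c], isDicycle_three (ne_of_adj hab) (ne_of_adj hca).symm (ne_of_adj hbc)
      hab hbc hca, by simp [ha, hb, hc], fun C hC v _ => ?_⟩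
    refine (card_le_card (t := {a, b, c}) fun u hu => ?_).trans card_le_three
    simpa [hC] using (mem_outIn.1 hu).1

/-- The `+ 2` avoids truncated subtraction. Nonemptiness is required only for `1 ≤ k`, since
deleting the last cycle may leave nothing. -/
theorem exists_disjoint_dicycles
    (hin : ∀ u v, part u = part v → ¬ D.Adj u v)
    (hadj : ∀ u v, part u ≠ part v → D.Adj u v ∨ D.Adj v u)
    (hasymm : ∀ u v, D.Adj u v → ¬ D.Adj v u) (k : ℕ) (S : Finset V)
    (hS : 1 ≤ k → S.Nonempty) (hdeg : ∀ v ∈ S, 3 * k ≤ #(D.outIn S v) + 2) :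
    ∃ c : Fin k → Cycle V, (∀ i, D.IsDicycle (c i)) ∧ (∀ i, ∀ v ∈ c i, v ∈ S) ∧
      ∀ i j, i ≠ j → ∀ v, v ∈ c i → v ∉ c j := by
  classical
  induction k generalizing S with
  | zero => exact ⟨fun i => i.elim0, fun i => i.elim0, fun i => i.elim0, fun i => i.elim0⟩
  | succ k ih =>
    obtain ⟨T, hTS, ⟨t, ht⟩, hdegT, l, hl, hlT, hlight⟩ :=
      exists_light_dicycle (m := 3 * k + 1) (by omega) (hS (by omega)) hin hadj hasymm
        fun v hv => by have := hdeg v hv; omega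
    have hcard : ∀ v ∈ T, 3 * k ≤ #(D.outIn (T \ l.toFinset) v) + 2 := by
      intro v hv
      have h₁ := hdegT v hv
      have h₂ := hlight l.toFinset (by simp) v hv
      have h₃ : D.outIn T v ⊆ D.outIn (T \ l.toFinset) v ∪ D.outIn l.toFinset v := by
        intro u hu
        obtain ⟨huT, hvu⟩ := mem_outIn.1 hu
        by_cases hul : u ∈ l <;> simp [hul, huT, hvu]
      have h₄ := (card_le_card h₃).trans (card_union_le _ _)
      omega
    obtain ⟨c, hc, hcS, hdisj⟩ := ih (T \ l.toFinset)
      -- For `1 ≤ k` the surviving out-degree of `t` is at least `3 * k - 2 ≥ 1`.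
      (fun hk => by
        have hpos : 0 < #(D.outIn (T \ l.toFinset) t) := by
          have := hcard t ht
          omega
        obtain ⟨u, hu⟩ := card_pos.1 hpos
        exact ⟨u, (mem_outIn.1 hu).1⟩)
      (fun v hv => hcard v (mem_sdiff.1 hv).1)
    have hcl : ∀ i, ∀ v ∈ c i, v ∉ (l : Cycle V) := fun i v hv hvl =>
      (mem_sdiff.1 (hcS i v hv)).2 (List.mem_toFinset.2 hvl)
    refine ⟨Fin.cons (l : Cycle V) c, Fin.cases hl hc,
      Fin.cases (fun v hv => hTS (hlT v hv))
        fun i v hv => hTS (mem_sdiff.1 (hcS i v hv)).1, ?_⟩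
    refine Fin.cases (Fin.cases (fun h => absurd rfl h) fun j _ v hv hvj => hcl j v hvj hv)
      fun i => Fin.cases (fun _ v hv => hcl i v hv) fun j hij => hdisj i j fun h => hij (h ▸ rfl)

end

end Digraph

theorem mainTheorem3 {V : Type*} [Finite V] [Nonempty V] (D : Digraph V)
    (hD : D.IsMultipartiteTournament) (k : ℕ)
    (hdeg : 3 * (k : ℤ) - 2 ≤ (D.minOutDegree : ℤ)) :
    D.HasDisjointDicycles k := by
  classical
  have := Fintype.ofFinite V
  obtain ⟨ℓ, -, part, hin, hxor⟩ := hD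
  have hasymm : ∀ u v, D.Adj u v → ¬ D.Adj v u := fun u v h h' => by
    rcases hxor u v fun hp => hin u v hp h with ⟨-, h₂⟩ | ⟨-, h₂⟩
    exacts [h₂ h', h₂ h]
  obtain ⟨c, hc, -, hdisj⟩ := Digraph.exists_disjoint_dicycles hin
    (fun u v h => (hxor u v h).imp And.left And.left) hasymm k Finset.univ
    (fun _ => Finset.univ_nonempty) fun v _ => by
      have h₁ : D.minOutDegree ≤ D.outDegree v := ciInf_le (OrderBot.bddBelow _) v
      have h₂ : D.outDegree v = (D.outIn Finset.univ v).card := by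
        rw [Digraph.outDegree, ← Set.ncard_coe_finset]
        congr 1
        ext w
        simp
      omega
  exact ⟨c, hc, hdisj⟩
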